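/- **Setting.** Let $n\ge 1$, $1\le s\le p$, and let $X$ be a fixed (non-random) $n\times p$ matrix whose columns are normalized, $\frac1n\sum_{i=1}^n x_{ij}^2=1$ for all $j$. Let $y=X\beta^*+w$, where the support of $\beta^*\in\mathbb R^p$ is $S=\{1,\dots,s\}$ (all entries of $\beta^*_S$ are non-zero, $\beta^*_{S^c}=0$) and $w_1,\dots,w_n$ are i.i.d., centered and sub-Gaussian with parameter $\sigma^2>0$, i.e. $\Pr(|w_i|>t)\le 2\exp(-t^2/(2\sigma^2))$ for all $t>0$. Put $\Sigma=\frac1n X'X$ and $\rho=\frac1n X'y$. Let $\widehat\Sigma$ (a random $p\times p$ matrix) and $\tilde\rho$ (a random vector in $\mathbb R^p$) be surrogates of $\Sigma$ and $\rho$, let $\widetilde\Sigma=(\widehat\Sigma)_+$ be a positive semidefinite matrix minimizing $\|\widehat\Sigma-K\|_{\max}$ over all positive semidefinite $K$ (any choice of the minimizer), and, for $\lambda>0$, let the CoCoLasso problem be $$\min_{\beta\in\mathbb R^p}\ \tfrac12\beta'\widetilde\Sigma\beta-\tilde\rho'\beta+\lambda\|\beta\|_1 .\qquad(1)$$ Here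 $\|K\|_{\max}=\max_{i,j}|k_{ij}|$, and $\|K\|_\infty=\max_i\sum_j|k_{ij}|$ for matrices (read as $0$ if $K$ has no rows); for vectors $\|\cdot\|_\infty$ is the maximum norm; $|\beta^*_{\min}|=\min_{j\in S}|\beta_j^*|$; $\Lambda_{\min}$ denotes the smallest eigenvalue. **Closeness condition** (with constants $C_0,c_0>0$ and values $\zeta,\varepsilon_0>0$). For every $0<\varepsilon\le\varepsilon_0$ and all $i,j\in\{1,\dots,p\}$, $$\Pr(|\widehat\Sigma_{ij}-\Sigma_{ij}|\ge\varepsilon)\le C_0\exp(-c_0n\varepsilon^2\zeta^{-1}),\qquad \Pr(|\tilde\rho_j-\rho_j|\ge\varepsilon)\le C_0\exp(-c_0ns^{-2}\varepsilon^2\zeta^{-1}).$$ **Theorem.** Assume the closeness condition, the irrepresentable condition $\|\Sigma_{S^c,S}\Sigma_{S,S}^{-1}\|_\infty=1-\gamma$ with $\gamma>0$, and $\Lambda_{\min}(\Sigma_{S,S})=C_{\min}>0$. Then there are positive constants $C,c$, depending only on $C_0,c_0$, and positive constants $\varepsilon_1,\varepsilon_2,\varepsilon_3$, which for given $C_0,c_0$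 depend only on $s$, $\Sigma_{S,S}$, $\beta^*_S$, $\gamma$ and $\varepsilon_0$, such that for all $0<\lambda\le\min(\varepsilon_0,4\varepsilon_0/\gamma)$ and all $0<\varepsilon\le\min(\varepsilon_1,\lambda/(\lambda\varepsilon_2+\varepsilon_3))$ the following three assertions hold simultaneously with probability at least $1-\delta_1$, where $$\delta_1=p^2C\exp\!\Big(-\frac{cn\gamma^2\lambda^2}{s^2\max(\zeta,\sigma^2)}\Big)+p^2C\exp\!\Big(-\frac{cn\varepsilon^2}{s^2\max(\zeta,\sigma^2)}\Big).$$ (a) Problem (1) has a unique minimizer $\hat\beta$ over $\mathbb R^p$, and the support of $\hat\beta$ is contained in $S$. (b) $\|\hat\beta_S-\beta^*_S\|_\infty\le\kappa\lambda$, where $\kappa=4\|\Sigma_{S,S}^{-1}\|_\infty+C_{\min}^{-1/2}$. (c) If $|\beta^*_{\min}|\ge\kappa\lambda$, then $\operatorname{sign}(\hat\beta_S)=\operatorname{sign}(\beta^*_S)$. -/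

import Mathlib

open MeasureTheory ProbabilityTheory

noncomputable section

namespace CoCoLasso

/-- Elementwise maximum norm `max_{i,j} |k_{ij}|` of a finite real matrix. -/
def maxNorm {ι κ : Type*} (K : Matrix ι κ ℝ) : ℝ := ⨆ ij : ι × κ, |K ij.1 ij.2|

/-- Matrix `ℓ_∞` norm `max_i ∑_j |k_{ij}|` (it is `0` for a matrix without rows). -/
def linftyNorm {ι κ : Type*} [Fintype κ] (K : Matrix ι κ ℝ) : ℝ := ⨆ i, ∑ j, |K i j|

/-- `m` is the smallest eigenvalue of the square matrix `K`. -/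
def IsMinEigenvalue {ι : Type*} [Fintype ι] [DecidableEq ι] (K : Matrix ι ι ℝ) (m : ℝ) : Prop :=
  IsLeast (spectrum ℝ K) m

/-- The Gram matrix `(1/n) X'X`. -/
def gram {n : ℕ} {ι : Type*} (X : Matrix (Fin n) ι ℝ) : Matrix ι ι ℝ :=
  (1 / (n : ℝ)) • (X.transpose * X)

/-- The vector `(1/n) X'y`. -/
def crossMoment {n : ℕ} {ι : Type*} (X : Matrix (Fin n) ι ℝ) (y : Fin n → ℝ) : ι → ℝ :=
  (1 / (n : ℝ)) • (X.transpose.mulVec y)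

/-- All columns satisfy `(1/n) ∑_i x_{ij}^2 = 1`. -/
def NormalizedColumns {n : ℕ} {ι : Type*} (X : Matrix (Fin n) ι ℝ) : Prop :=
  ∀ j, (1 / (n : ℝ)) * ∑ i, X i j ^ 2 = 1

/-- The full coefficient vector `(β_S, 0)`. -/
def fullCoef {s r : ℕ} (βS : Fin s → ℝ) : Fin s ⊕ Fin r → ℝ := Sum.elim βS 0

/-- `K₁` is a value of the projection `(K)_+`: a positive semidefinite matrix at smallest
elementwise maximum distance from `K`. -/
def IsNearestPSD {ι : Type*} (K K₁ : Matrix ι ι ℝ) : Prop :=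
  K₁.PosSemidef ∧ ∀ K₂ : Matrix ι ι ℝ, K₂.PosSemidef → maxNorm (K - K₁) ≤ maxNorm (K - K₂)

/-- The objective `(1/2) β'Kβ - ρ'β + lam ‖β‖₁`. -/
def objective {ι : Type*} [Fintype ι] (K : Matrix ι ι ℝ) (ρ : ι → ℝ) (lam : ℝ) (β : ι → ℝ) : ℝ :=
  (1 / 2) * dotProduct β (K.mulVec β) - dotProduct ρ β + lam * ∑ j, |β j|

/-- `β` minimizes the objective over all coefficient vectors. -/
def IsSolution {ι : Type*} [Fintype ι] (K : Matrix ι ι ℝ) (ρ : ι → ℝ) (lam : ℝ)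
    (β : ι → ℝ) : Prop :=
  ∀ β' : ι → ℝ, objective K ρ lam β ≤ objective K ρ lam β'

/-- The `w i` are i.i.d., centered, and sub-Gaussian with parameter (at most) `σ ^ 2`:
`P(|w_i| > t) ≤ 2 exp(-t^2 / (2 σ^2))` for all `t > 0`. -/
structure IsSubGaussianNoise {Ω : Type*} [MeasurableSpace Ω] (P : Measure Ω) {n : ℕ}
    (w : Fin n → Ω → ℝ) (σ : ℝ) : Prop where
  measurable : ∀ i, Measurable (w i)
  indep : iIndepFun w P
  identDistrib : ∀ i j, IdentDistrib (w i) (w j) P P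
  mean_zero : ∀ i, ∫ ω, w i ω ∂P = 0
  tail : ∀ i, ∀ t : ℝ, 0 < t →
    P.real {ω | t < |w i ω|} ≤ 2 * Real.exp (-(t ^ 2 / (2 * σ ^ 2)))

/-- The closeness condition, with constants `C`, `c` and values `ζ`, `ε₀`, for the surrogates
`Khat` of the matrix `K` and `ρtil` of the (random) vector `ρ`; `n` is the sample size and `s`
the number of nonzero coefficients. -/
def Closeness {Ω : Type*} [MeasurableSpace Ω] (P : Measure Ω) {ι : Type*} (n s : ℕ)
    (C c ζ ε₀ : ℝ) (K : Matrix ι ι ℝ) (ρ : Ω → ι → ℝ)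
    (Khat : Ω → Matrix ι ι ℝ) (ρtil : Ω → ι → ℝ) : Prop :=
  ∀ ε : ℝ, 0 < ε → ε ≤ ε₀ →
    (∀ i j, P.real {ω | ε ≤ |Khat ω i j - K i j|} ≤
      C * Real.exp (-(c * n * ε ^ 2 / ζ))) ∧
    (∀ j, P.real {ω | ε ≤ |ρtil ω j - ρ ω j|} ≤
      C * Real.exp (-(c * n * ε ^ 2 / ((s : ℝ) ^ 2 * ζ))))

/-- `p² C exp(-c n s⁻² γ² lam² / ζ) + p² C exp(-c n s⁻² ε² / ζ)`. -/
def failureBound (C c : ℝ) (n p s : ℕ) (γ lam ε ζ : ℝ) : ℝ :=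
  (p : ℝ) ^ 2 * C * Real.exp (-(c * n * γ ^ 2 * lam ^ 2 / ((s : ℝ) ^ 2 * ζ))) +
  (p : ℝ) ^ 2 * C * Real.exp (-(c * n * ε ^ 2 / ((s : ℝ) ^ 2 * ζ)))

/-- `κ = 4 ‖Σ_{S,S}⁻¹‖_∞ + C_min^{-1/2}`. -/
def kappa {s : ℕ} (A : Matrix (Fin s) (Fin s) ℝ) (Cmin : ℝ) : ℝ :=
  4 * linftyNorm A⁻¹ + 1 / Real.sqrt Cmin

end CoCoLasso

end

/-!
The proof is the primal-dual witness argument on an event of high probability.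

*Deterministic part.* Write `S` for the Gram matrix, `A` for its block on the true support, and let
`K` be the projected surrogate. A nearest positive semidefinite matrix is at most twice as far from
`S` as the raw surrogate is (`IsNearestPSD.abs_sub_le`), because `S` is itself positive
semidefinite. If `K` is entrywise close to `S`, then `‖u‖ ≤ 2 ‖A⁻¹‖_∞ ‖K₁₁ u‖`
(`norm_le_of_perturbed`), so the problem restricted to the support is strictly convex and has a
solution `b`; and `K₂₁ u` is at most `(1 - γ/2) ‖K₁₁ u‖` (`abs_toBlocks₂₁_mulVec_le`), which is
the irrepresentable condition for `K` with half of the margin. Stationarity of `b` bounds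
`K₁₁ (b - βS)` by `lam (1 + γ/8)`. The first estimate turns this into the `ℓ_∞` bound on `b - βS`,
the second into strict dual feasibility off the support, so that `(b, 0)` is the unique solution of
the full problem (`isSolution_unique_of_strict_dual`). These steps are joined in
`exists_unique_solution_of_close`.

*Probabilistic part.* The residual `ρtil - S β*` is the error of the surrogate `ρtil` plus the
noise average `X'w / n`. The former is controlled by the closeness condition. For the latter, the
tail hypothesis is turned into a bound on the moment generating function
(`hasSubgaussianMGF_of_tail`), and Hoeffding's inequality applies to the weighted sum, whose
weights have square sum `1 / n` by the normalization of the columns. A union bound gives the event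
(`exists_good_event`).
-/

namespace CoCoLasso

open Matrix

/-! ### Entrywise and row-sum bounds -/

theorem linftyNorm_nonneg {ι κ : Type*} [Fintype κ] (K : Matrix ι κ ℝ) : 0 ≤ linftyNorm K :=
  Real.iSup_nonneg fun _ => Finset.sum_nonneg fun _ _ => abs_nonneg _

theorem abs_mulVec_le_linftyNorm {ι κ : Type*} [Finite ι] [Fintype κ] (K : Matrix ι κ ℝ)
    (v : κ → ℝ) (i : ι) : |(K *ᵥ v) i| ≤ linftyNorm K * ‖v‖ := by
  have h1 : ∑ j, |K i j| ≤ linftyNorm K :=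
    le_ciSup (f := fun i => ∑ j, |K i j|) (Set.finite_range _).bddAbove i
  calc |(K *ᵥ v) i| ≤ ∑ j, |K i j * v j| := Finset.abs_sum_le_sum_abs _ _
    _ ≤ ∑ j, |K i j| * ‖v‖ := by
        refine Finset.sum_le_sum fun j _ => ?_
        rw [abs_mul]
        exact mul_le_mul_of_nonneg_left (norm_le_pi_norm v j) (abs_nonneg _)
    _ = (∑ j, |K i j|) * ‖v‖ := by rw [Finset.sum_mul]
    _ ≤ _ := mul_le_mul_of_nonneg_right h1 (norm_nonneg _)

theorem abs_mulVec_le_of_forall_abs_le {ι κ : Type*} [Fintype κ] {K : Matrix ι κ ℝ} {D : ℝ}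
    (hK : ∀ i j, |K i j| ≤ D) (v : κ → ℝ) (i : ι) : |(K *ᵥ v) i| ≤ D * ∑ j, |v j| := by
  calc |(K *ᵥ v) i| ≤ ∑ j, |K i j * v j| := Finset.abs_sum_le_sum_abs _ _
    _ ≤ ∑ j, D * |v j| := by
        refine Finset.sum_le_sum fun j _ => ?_
        rw [abs_mul]
        exact mul_le_mul_of_nonneg_right (hK i j) (abs_nonneg _)
    _ = _ := by rw [Finset.mul_sum]

theorem sum_abs_le_card_mul_norm {ι : Type*} [Fintype ι] (v : ι → ℝ) :
    ∑ j, |v j| ≤ Fintype.card ι * ‖v‖ := by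
  calc ∑ j, |v j| ≤ ∑ _j : ι, ‖v‖ := Finset.sum_le_sum fun j _ => norm_le_pi_norm v j
    _ = _ := by simp

theorem norm_le_sum_abs {ι : Type*} [Fintype ι] (v : ι → ℝ) : ‖v‖ ≤ ∑ j, |v j| :=
  (pi_norm_le_iff_of_nonneg (Finset.sum_nonneg fun _ _ => abs_nonneg _)).2 fun i =>
    Finset.single_le_sum (f := fun j => |v j|) (fun _ _ => abs_nonneg _) (Finset.mem_univ i)

/-! ### Optimality conditions for the quadratic lasso problem -/

section Lasso

variable {ι κ : Type*} [Fintype ι] [Fintype κ]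

theorem objective_add {K : Matrix ι ι ℝ} (hK : K.IsHermitian) (ρ : ι → ℝ) (lam : ℝ)
    (β h : ι → ℝ) :
    objective K ρ lam (β + h) = objective K ρ lam β + (1 / 2) * (h ⬝ᵥ K *ᵥ h)
      - (ρ - K *ᵥ β) ⬝ᵥ h + lam * (∑ j, |β j + h j| - ∑ j, |β j|) := by
  have hT : Kᵀ = K := by simpa [IsHermitian, conjTranspose_eq_transpose_of_trivial] using hK
  have h1 : β ⬝ᵥ K *ᵥ h = h ⬝ᵥ K *ᵥ β := by
    rw [dotProduct_mulVec, ← mulVec_transpose, hT, dotProduct_comm]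
  have h2 : (K *ᵥ β) ⬝ᵥ h = h ⬝ᵥ K *ᵥ β := dotProduct_comm _ _
  simp only [objective, mulVec_add, dotProduct_add, add_dotProduct, sub_dotProduct, Pi.add_apply,
    h1, h2]
  ring

/-- If `ρ` lies in the range of `K`, the quadratic part is bounded below by completing the
square, so that the `ℓ₁` penalty alone makes the objective coercive. -/
theorem exists_isSolution {K : Matrix ι ι ℝ} (hK : K.PosSemidef) {ρ : ι → ℝ}
    (hρ : ∃ b, K *ᵥ b = ρ) {lam : ℝ} (hlam : 0 < lam) : ∃ β, IsSolution K ρ lam β := by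
  obtain ⟨b, rfl⟩ := hρ
  have hcont : Continuous (objective K (K *ᵥ b) lam) := by
    unfold objective; fun_prop
  have hlow : ∀ β, objective K (K *ᵥ b) lam b - lam * ∑ j, |b j| + lam * ‖β‖ ≤
      objective K (K *ᵥ b) lam β := by
    intro β
    have h1 := objective_add hK.isHermitian (K *ᵥ b) lam b (β - b)
    have h2 : 0 ≤ (β - b) ⬝ᵥ K *ᵥ (β - b) := by
      simpa using hK.dotProduct_mulVec_nonneg (β - b)
    have h3 := mul_le_mul_of_nonneg_left (norm_le_sum_abs β) hlam.le
    simp only [add_sub_cancel, sub_self, zero_dotProduct, Pi.sub_apply] at h1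
    rw [h1]
    linarith
  refine hcont.exists_forall_le (Filter.tendsto_atTop_mono hlow ?_)
  exact Filter.tendsto_atTop_add_const_left _ _
    ((tendsto_norm_cocompact_atTop (E := ι → ℝ)).const_mul_atTop hlam)

/-- First-order optimality: the residual `ρ - Kβ` is a subgradient of `lam ‖·‖₁` at `β`. -/
theorem IsSolution.residual_dotProduct_le {K : Matrix ι ι ℝ} (hK : K.PosSemidef) {ρ : ι → ℝ}
    {lam : ℝ} (hlam : 0 ≤ lam) {β : ι → ℝ} (hβ : IsSolution K ρ lam β) (v : ι → ℝ) :
    (ρ - K *ᵥ β) ⬝ᵥ v ≤ lam * (∑ j, |β j + v j| - ∑ j, |β j|) := by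
  set Q := v ⬝ᵥ K *ᵥ v with hQ
  have hQ0 : 0 ≤ Q := by simpa using hK.dotProduct_mulVec_nonneg v
  have key : ∀ θ : ℝ, 0 < θ → θ ≤ 1 →
      (ρ - K *ᵥ β) ⬝ᵥ v ≤ θ * Q + lam * (∑ j, |β j + v j| - ∑ j, |β j|) := by
    intro θ h0 h1
    have h2 := hβ (β + θ • v)
    rw [objective_add hK.isHermitian] at h2
    simp only [mulVec_smul, dotProduct_smul, smul_dotProduct, smul_eq_mul, Pi.smul_apply,
      ← hQ] at h2
    have h3 : ∑ j, |β j + θ * v j| ≤ (1 - θ) * ∑ j, |β j| + θ * ∑ j, |β j + v j| := by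
      rw [Finset.mul_sum, Finset.mul_sum, ← Finset.sum_add_distrib]
      refine Finset.sum_le_sum fun j _ => ?_
      calc |β j + θ * v j| = |(1 - θ) * β j + θ * (β j + v j)| := by ring_nf
        _ ≤ |(1 - θ) * β j| + |θ * (β j + v j)| := abs_add_le _ _
        _ = _ := by rw [abs_mul, abs_mul, abs_of_nonneg (sub_nonneg.2 h1), abs_of_pos h0]
    have h4 := mul_le_mul_of_nonneg_left h3 hlam
    have h5 : 0 ≤ θ * Q := mul_nonneg h0.le hQ0
    have h6 : θ * ((ρ - K *ᵥ β) ⬝ᵥ v) ≤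
        θ * (θ * Q + lam * (∑ j, |β j + v j| - ∑ j, |β j|)) := by nlinarith
    exact le_of_mul_le_mul_left h6 h0
  refine le_of_forall_pos_le_add fun δ hδ => ?_
  have h1 := key (min 1 (δ / (Q + 1))) (by positivity) (min_le_left _ _)
  have h2 : min 1 (δ / (Q + 1)) * Q ≤ δ := by
    calc min 1 (δ / (Q + 1)) * Q ≤ δ / (Q + 1) * (Q + 1) :=
          mul_le_mul (min_le_right _ _) (by linarith) hQ0 (by positivity)
      _ = δ := div_mul_cancel₀ _ (by positivity)
  linarith

theorem IsSolution.residual_dotProduct_self {K : Matrix ι ι ℝ} (hK : K.PosSemidef) {ρ : ι → ℝ}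
    {lam : ℝ} (hlam : 0 ≤ lam) {β : ι → ℝ} (hβ : IsSolution K ρ lam β) :
    (ρ - K *ᵥ β) ⬝ᵥ β = lam * ∑ j, |β j| := by
  have h1 := hβ.residual_dotProduct_le hK hlam β
  have h2 := hβ.residual_dotProduct_le hK hlam (-β)
  have h3 : ∑ j, |β j + β j| = 2 * ∑ j, |β j| := by
    rw [Finset.mul_sum]
    refine Finset.sum_congr rfl fun j _ => ?_
    rw [← two_mul, abs_mul, abs_two]
  simp only [h3, dotProduct_neg, Pi.neg_apply, add_neg_cancel, abs_zero,
    Finset.sum_const_zero] at h1 h2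
  linarith

theorem IsSolution.abs_residual_le {K : Matrix ι ι ℝ} (hK : K.PosSemidef) {ρ : ι → ℝ}
    {lam : ℝ} (hlam : 0 ≤ lam) {β : ι → ℝ} (hβ : IsSolution K ρ lam β) (i : ι) :
    |(ρ - K *ᵥ β) i| ≤ lam := by
  classical
  have key : ∀ a : ℝ, |a| = 1 → (ρ - K *ᵥ β) i * a ≤ lam := by
    intro a ha
    have h1 := hβ.residual_dotProduct_le hK hlam (Pi.single i a)
    rw [dotProduct_single] at h1
    have h2 : ∑ j, |β j + (Pi.single i a : ι → ℝ) j| ≤ ∑ j, |β j| + 1 := by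
      calc ∑ j, |β j + (Pi.single i a : ι → ℝ) j|
          ≤ ∑ j, (|β j| + |(Pi.single i a : ι → ℝ) j|) :=
            Finset.sum_le_sum fun j _ => abs_add_le _ _
        _ = ∑ j, |β j| + ∑ j, |(Pi.single i a : ι → ℝ) j| := Finset.sum_add_distrib
        _ = ∑ j, |β j| + 1 := by
            congr 1
            rw [Finset.sum_eq_single i (fun j _ hj => by simp [hj]) (by simp)]
            simp [ha]
    nlinarith
  rw [abs_le]
  have h1 := key 1 (by simp)
  have h2 := key (-1) (by simp)
  constructor <;> linarith

/-- The primal-dual witness argument. A solution `b` of the problem restricted to the first block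
of coordinates extends by zero to the unique solution of the whole problem as soon as the
dual constraint is strict on the second block. -/
theorem isSolution_unique_of_strict_dual {K : Matrix (ι ⊕ κ) (ι ⊕ κ) ℝ} (hK : K.PosSemidef)
    (hinj : ∀ u, K.toBlocks₁₁ *ᵥ u = 0 → u = 0) {ρ : ι ⊕ κ → ℝ} {lam : ℝ} (hlam : 0 ≤ lam)
    {b : ι → ℝ} (hb : IsSolution K.toBlocks₁₁ (fun j => ρ (Sum.inl j)) lam b)
    (hdual : ∀ j, |ρ (Sum.inr j) - (K.toBlocks₂₁ *ᵥ b) j| < lam) :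
    IsSolution K ρ lam (Sum.elim b 0) ∧
      ∀ β, IsSolution K ρ lam β → β = Sum.elim b 0 := by
  have hK₁ : K.toBlocks₁₁.PosSemidef := hK.submatrix Sum.inl
  set β₀ : ι ⊕ κ → ℝ := Sum.elim b 0 with hβ₀
  set g := ρ - K *ᵥ β₀ with hg
  have hmul : K *ᵥ β₀ = Sum.elim (K.toBlocks₁₁ *ᵥ b) (K.toBlocks₂₁ *ᵥ b) := by
    conv_lhs => rw [← fromBlocks_toBlocks K]
    rw [fromBlocks_mulVec]
    simp [hβ₀, Sum.elim_comp_inl, Sum.elim_comp_inr]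
  have hg₁ : (fun i => g (Sum.inl i)) = (fun i => ρ (Sum.inl i)) - K.toBlocks₁₁ *ᵥ b := by
    ext i
    simp [hg, hmul]
  have hgl : ∀ i, |g (Sum.inl i)| ≤ lam := fun i => by
    simpa [hg, hmul] using hb.abs_residual_le hK₁ hlam i
  have hgr : ∀ j, |g (Sum.inr j)| < lam := fun j => by simpa [hg, hmul] using hdual j
  have hgβ : g ⬝ᵥ β₀ = lam * ∑ j, |β₀ j| := by
    have h := hb.residual_dotProduct_self hK₁ hlam
    rw [← hg₁] at h
    simpa [hβ₀, dotProduct, Fintype.sum_sum_type] using h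
  have hterm : ∀ (β : ι ⊕ κ → ℝ) j, 0 ≤ lam * |β j| - g j * β j := by
    intro β j
    have h1 : |g j| ≤ lam := by
      cases j with
      | inl i => exact hgl i
      | inr j => exact (hgr j).le
    have h2 := mul_le_mul_of_nonneg_right h1 (abs_nonneg (β j))
    have h3 := le_abs_self (g j * β j)
    rw [abs_mul] at h3
    linarith
  -- The excess of the objective over its value at `β₀` is a sum of nonnegative terms.
  have hexc : ∀ β, objective K ρ lam β = objective K ρ lam β₀
      + (1 / 2) * ((β - β₀) ⬝ᵥ K *ᵥ (β - β₀)) + ∑ j, (lam * |β j| - g j * β j) := by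
    intro β
    have h1 := objective_add hK.isHermitian ρ lam β₀ (β - β₀)
    have h2 : ∑ j, (lam * |β j| - g j * β j) = lam * ∑ j, |β j| - g ⬝ᵥ β := by
      rw [Finset.sum_sub_distrib, Finset.mul_sum, dotProduct]
    simp only [add_sub_cancel, Pi.sub_apply, ← hg, dotProduct_sub, hgβ] at h1
    rw [h1, h2]
    ring
  have hQ : ∀ v, 0 ≤ v ⬝ᵥ K *ᵥ v := fun v => by simpa using hK.dotProduct_mulVec_nonneg v
  refine ⟨fun β => ?_, fun β hβ => ?_⟩
  · rw [hexc β]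
    have := hQ (β - β₀)
    have := Finset.sum_nonneg fun j (_ : j ∈ Finset.univ) => hterm β j
    linarith
  · have h1 := hβ β₀
    rw [hexc β] at h1
    have h2 := hQ (β - β₀)
    have h3 := Finset.sum_nonneg fun j (_ : j ∈ Finset.univ) => hterm β j
    have h4 : ∑ j, (lam * |β j| - g j * β j) = 0 := by linarith
    have h5 : (β - β₀) ⬝ᵥ K *ᵥ (β - β₀) = 0 := by linarith
    have h6 := (Finset.sum_eq_zero_iff_of_nonneg fun j _ => hterm β j).1 h4
    have hr : ∀ j, β (Sum.inr j) = 0 := by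
      intro j
      by_contra hne
      have h7 := h6 (Sum.inr j) (Finset.mem_univ _)
      have h8 := mul_lt_mul_of_pos_right (hgr j) (abs_pos.2 hne)
      have h9 := le_abs_self (g (Sum.inr j) * β (Sum.inr j))
      rw [abs_mul] at h9
      linarith
    have h7 : K *ᵥ (β - β₀) = 0 :=
      (hK.dotProduct_mulVec_zero_iff (β - β₀)).1 (by simpa using h5)
    set u : ι → ℝ := fun i => β (Sum.inl i) - b i with hu
    have h8 : β - β₀ = Sum.elim u 0 := by
      ext j
      cases j <;> simp [hβ₀, hu, hr]
    have h9 : u = 0 := by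
      refine hinj u ?_
      rw [h8, ← fromBlocks_toBlocks K, fromBlocks_mulVec] at h7
      ext i
      have := congrFun h7 (Sum.inl i)
      simpa [Sum.elim_comp_inl, Sum.elim_comp_inr] using this
    rw [← sub_eq_zero, h8, h9]
    ext j
    cases j <;> simp

end Lasso

/-! ### Perturbation of the Gram matrix -/

section Perturbation

variable {ι κ : Type*} [Fintype ι] [DecidableEq ι] [Fintype κ]

/-- An entrywise perturbation of an invertible matrix at most doubles the bound on the inverse. -/
theorem norm_le_of_perturbed {A K : Matrix ι ι ℝ} (hA : IsUnit A) {D : ℝ}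
    (hD : ∀ i j, |K i j - A i j| ≤ D) (hsmall : 2 * (Fintype.card ι * D * linftyNorm A⁻¹) ≤ 1)
    (hD0 : 0 ≤ D) (u : ι → ℝ) : ‖u‖ ≤ 2 * linftyNorm A⁻¹ * ‖K *ᵥ u‖ := by
  have hM := linftyNorm_nonneg A⁻¹
  have hdet : IsUnit A.det := (Matrix.isUnit_iff_isUnit_det A).1 hA
  have h1 : u = A⁻¹ *ᵥ (K *ᵥ u - (K - A) *ᵥ u) := by
    rw [sub_mulVec, sub_sub_cancel, mulVec_mulVec, nonsing_inv_mul A hdet, one_mulVec]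
  have h2 : ‖(K - A) *ᵥ u‖ ≤ D * (Fintype.card ι * ‖u‖) := by
    refine (pi_norm_le_iff_of_nonneg (by positivity)).2 fun i => ?_
    exact (abs_mulVec_le_of_forall_abs_le (K := K - A) hD u i).trans
      (mul_le_mul_of_nonneg_left (sum_abs_le_card_mul_norm u) hD0)
  have h3 : ‖u‖ ≤ linftyNorm A⁻¹ * ‖K *ᵥ u - (K - A) *ᵥ u‖ := by
    refine (pi_norm_le_iff_of_nonneg (by positivity)).2 fun i => ?_
    conv_lhs => rw [h1]
    exact abs_mulVec_le_linftyNorm _ _ _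
  have h4 := (norm_sub_le (K *ᵥ u) ((K - A) *ᵥ u)).trans (add_le_add_right h2 _)
  have h5 := mul_le_mul_of_nonneg_left h4 hM
  have h6 := mul_le_mul_of_nonneg_right hsmall (norm_nonneg u)
  nlinarith

/-- The irrepresentable condition survives a small entrywise perturbation, with half the margin:
this bounds `K₂₁ K₁₁⁻¹` without inverting the perturbed block `K₁₁`. -/
theorem abs_toBlocks₂₁_mulVec_le {S K : Matrix (ι ⊕ κ) (ι ⊕ κ) ℝ} (hA : IsUnit S.toBlocks₁₁)
    {D γ : ℝ} (hD : ∀ i j, |K i j - S i j| ≤ D) (hD0 : 0 ≤ D) (hγ : 0 < γ)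
    (hirr : linftyNorm (S.toBlocks₂₁ * S.toBlocks₁₁⁻¹) = 1 - γ)
    (hsmall : 8 * (Fintype.card ι * D * linftyNorm S.toBlocks₁₁⁻¹) ≤ γ) (u : ι → ℝ) (j : κ) :
    |(K.toBlocks₂₁ *ᵥ u) j| ≤ (1 - γ / 2) * ‖K.toBlocks₁₁ *ᵥ u‖ := by
  have hγ1 : 0 ≤ 1 - γ := hirr ▸ linftyNorm_nonneg _
  have hdet : IsUnit S.toBlocks₁₁.det := (Matrix.isUnit_iff_isUnit_det _).1 hA
  have hu := norm_le_of_perturbed hA (K := K.toBlocks₁₁) (fun i j => hD (Sum.inl i) (Sum.inl j))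
    (by linarith) hD0 u
  set v := K.toBlocks₁₁ *ᵥ u with hv
  set M := linftyNorm S.toBlocks₁₁⁻¹
  have h1 : K.toBlocks₂₁ *ᵥ u = (S.toBlocks₂₁ * S.toBlocks₁₁⁻¹) *ᵥ
      (v - (K.toBlocks₁₁ - S.toBlocks₁₁) *ᵥ u) + (K.toBlocks₂₁ - S.toBlocks₂₁) *ᵥ u := by
    rw [sub_mulVec, ← hv, sub_sub_cancel, mulVec_mulVec, Matrix.mul_assoc,
      nonsing_inv_mul _ hdet, Matrix.mul_one, sub_mulVec, add_sub_cancel]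
  have h2 : ‖(K.toBlocks₁₁ - S.toBlocks₁₁) *ᵥ u‖ ≤ D * (Fintype.card ι * ‖u‖) := by
    refine (pi_norm_le_iff_of_nonneg (by positivity)).2 fun i => ?_
    exact (abs_mulVec_le_of_forall_abs_le (K := K.toBlocks₁₁ - S.toBlocks₁₁)
      (fun i j => hD (Sum.inl i) (Sum.inl j)) u i).trans
      (mul_le_mul_of_nonneg_left (sum_abs_le_card_mul_norm u) hD0)
  have h3 : |((K.toBlocks₂₁ - S.toBlocks₂₁) *ᵥ u) j| ≤ D * (Fintype.card ι * ‖u‖) :=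
    (abs_mulVec_le_of_forall_abs_le (K := K.toBlocks₂₁ - S.toBlocks₂₁)
      (fun i j => hD (Sum.inr i) (Sum.inl j)) u j).trans
      (mul_le_mul_of_nonneg_left (sum_abs_le_card_mul_norm u) hD0)
  have h4 := abs_mulVec_le_linftyNorm (S.toBlocks₂₁ * S.toBlocks₁₁⁻¹)
    (v - (K.toBlocks₁₁ - S.toBlocks₁₁) *ᵥ u) j
  rw [hirr] at h4
  have h5 := mul_le_mul_of_nonneg_left
    ((norm_sub_le v ((K.toBlocks₁₁ - S.toBlocks₁₁) *ᵥ u)).trans (add_le_add_right h2 _)) hγ1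
  have h6 : D * (Fintype.card ι * ‖u‖) ≤ γ / 4 * ‖v‖ := by
    have := mul_le_mul_of_nonneg_left hu (by positivity : 0 ≤ D * (Fintype.card ι : ℝ))
    have := mul_le_mul_of_nonneg_right hsmall (norm_nonneg v)
    nlinarith
  have h7 : (1 - γ) * (D * (Fintype.card ι * ‖u‖)) ≤ D * (Fintype.card ι * ‖u‖) :=
    mul_le_of_le_one_left (by positivity) (by linarith)
  rw [h1, Pi.add_apply]
  refine (abs_add_le _ _).trans ?_
  nlinarith

/-- The deterministic core: if `K` is entrywise within `D` of `S` and `ρ` is within `η` of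
`S (βS, 0)`, with `D` and `η` small relative to the irrepresentability margin, then the lasso
problem has a unique solution, supported on the first block and close to `βS`. -/
theorem exists_unique_solution_of_close {S K : Matrix (ι ⊕ κ) (ι ⊕ κ) ℝ} (hK : K.PosSemidef)
    (hA : IsUnit S.toBlocks₁₁) {D γ η lam : ℝ} (hD : ∀ i j, |K i j - S i j| ≤ D) (hD0 : 0 ≤ D)
    (hγ : 0 < γ) (hirr : linftyNorm (S.toBlocks₂₁ * S.toBlocks₁₁⁻¹) = 1 - γ)
    (hsmall : 8 * (Fintype.card ι * D * linftyNorm S.toBlocks₁₁⁻¹) ≤ γ)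
    (hlam : 0 < lam) (hη0 : 0 ≤ η) {βS : ι → ℝ} {ρ : ι ⊕ κ → ℝ}
    (hρ : ∀ j, |ρ j - (S *ᵥ Sum.elim βS 0) j| ≤ η) (hη : η + D * ∑ j, |βS j| ≤ γ * lam / 8) :
    ∃ b : ι → ℝ, (IsSolution K ρ lam (Sum.elim b 0) ∧
      ∀ β, IsSolution K ρ lam β → β = Sum.elim b 0) ∧
      ‖b - βS‖ ≤ 4 * linftyNorm S.toBlocks₁₁⁻¹ * lam := by
  have hγ1 : 0 ≤ 1 - γ := hirr ▸ linftyNorm_nonneg _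
  have hM := linftyNorm_nonneg S.toBlocks₁₁⁻¹
  have hB : 0 ≤ ∑ j, |βS j| := Finset.sum_nonneg fun _ _ => abs_nonneg _
  have hK₁ : K.toBlocks₁₁.PosSemidef := hK.submatrix Sum.inl
  have hnorm := norm_le_of_perturbed hA (K := K.toBlocks₁₁)
    (fun i j => hD (Sum.inl i) (Sum.inl j)) (by linarith) hD0
  have hinj : ∀ u, K.toBlocks₁₁ *ᵥ u = 0 → u = 0 := by
    intro u hu
    have h := hnorm u
    rw [hu, norm_zero, mul_zero] at h
    exact norm_le_zero_iff.1 h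
  have hinj' : Function.Injective K.toBlocks₁₁.mulVec := by
    intro u v huv
    exact sub_eq_zero.1 (hinj _ (by rw [mulVec_sub]; exact sub_eq_zero.2 huv))
  have hsurj : Function.Surjective K.toBlocks₁₁.mulVec :=
    mulVec_surjective_iff_isUnit.2 (mulVec_injective_iff_isUnit.1 hinj')
  obtain ⟨b, hb⟩ := exists_isSolution hK₁ (hsurj fun j => ρ (Sum.inl j)) hlam
  have hmul : S *ᵥ Sum.elim βS 0 = Sum.elim (S.toBlocks₁₁ *ᵥ βS) (S.toBlocks₂₁ *ᵥ βS) := by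
    conv_lhs => rw [← fromBlocks_toBlocks S]
    rw [fromBlocks_mulVec]
    simp [Sum.elim_comp_inl, Sum.elim_comp_inr]
  rw [hmul] at hρ
  have hv : ‖K.toBlocks₁₁ *ᵥ (b - βS)‖ ≤ η + D * ∑ j, |βS j| + lam := by
    refine (pi_norm_le_iff_of_nonneg (by positivity)).2 fun i => ?_
    have h1 := abs_le.1 (hb.abs_residual_le hK₁ hlam.le i)
    have h2 := abs_le.1 (hρ (Sum.inl i))
    have h3 := abs_le.1 (abs_mulVec_le_of_forall_abs_le (K := K.toBlocks₁₁ - S.toBlocks₁₁)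
      (fun i j => hD (Sum.inl i) (Sum.inl j)) βS i)
    simp only [sub_mulVec, mulVec_sub, Pi.sub_apply, Sum.elim_inl] at h1 h2 h3 ⊢
    rw [Real.norm_eq_abs, abs_le]
    constructor <;> linarith [h1.1, h1.2, h2.1, h2.2, h3.1, h3.2]
  refine ⟨b, isSolution_unique_of_strict_dual hK hinj hlam.le hb fun j => ?_, ?_⟩
  · have h1 := abs_le.1 (abs_toBlocks₂₁_mulVec_le hA hD hD0 hγ hirr hsmall (b - βS) j)
    have h2 := abs_le.1 (hρ (Sum.inr j))
    have h3 := abs_le.1 (abs_mulVec_le_of_forall_abs_le (K := K.toBlocks₂₁ - S.toBlocks₂₁)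
      (fun i j => hD (Sum.inr i) (Sum.inl j)) βS j)
    have h4 := mul_le_mul_of_nonneg_left hv (by linarith : 0 ≤ 1 - γ / 2)
    have h5 : 0 ≤ γ / 2 * (η + D * ∑ j, |βS j|) := by positivity
    have h6 : 0 < γ * lam := by positivity
    simp only [sub_mulVec, mulVec_sub, Pi.sub_apply, Sum.elim_inr] at h1 h2 h3 h4 ⊢
    rw [abs_lt]
    constructor <;> nlinarith [h1.1, h1.2, h2.1, h2.2, h3.1, h3.2]
  · have h1 : η + D * ∑ j, |βS j| + lam ≤ 2 * lam := by nlinarith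
    calc ‖b - βS‖ ≤ 2 * linftyNorm S.toBlocks₁₁⁻¹ * ‖K.toBlocks₁₁ *ᵥ (b - βS)‖ := hnorm _
      _ ≤ 2 * linftyNorm S.toBlocks₁₁⁻¹ * (2 * lam) :=
          mul_le_mul_of_nonneg_left (hv.trans h1) (by positivity)
      _ = _ := by ring

/-- A nearest positive semidefinite matrix is entrywise within `2 D` of every positive
semidefinite matrix that is within `D` of the original one. -/
theorem IsNearestPSD.abs_sub_le {ι : Type*} [Finite ι] {K K₁ S : Matrix ι ι ℝ}
    (h : IsNearestPSD K K₁) (hS : S.PosSemidef) {D : ℝ} (hD0 : 0 ≤ D)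
    (hD : ∀ i j, |K i j - S i j| ≤ D) (i j : ι) : |K₁ i j - S i j| ≤ 2 * D := by
  have h1 : maxNorm (K - S) ≤ D := Real.iSup_le (fun ij => hD ij.1 ij.2) hD0
  have h2 : |(K - K₁) i j| ≤ maxNorm (K - K₁) :=
    le_ciSup (f := fun ij : ι × ι => |(K - K₁) ij.1 ij.2|) (Set.finite_range _).bddAbove (i, j)
  have h3 := abs_le.1 (h2.trans ((h.2 S hS).trans h1))
  have h4 := abs_le.1 (hD i j)
  rw [Matrix.sub_apply] at h3
  rw [abs_le]
  constructor <;> linarith [h3.1, h3.2, h4.1, h4.2]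

end Perturbation

end CoCoLasso

namespace CoCoLasso

/-! ### From sub-Gaussian tails to the moment generating function -/

section Tail

open Real

theorem exp_le_add_exp_sq (x : ℝ) : exp x ≤ x + exp (x ^ 2) := by
  have hsq := add_one_le_exp (x ^ 2)
  rcases le_total |x| 1 with h | h
  · have := (abs_le.1 (abs_exp_sub_one_sub_id_le h)).2
    linarith
  · rcases le_abs.1 h with h | h
    · have : exp x ≤ exp (x ^ 2) := exp_le_exp.2 (by nlinarith)
      linarith
    · have : exp x ≤ 1 := exp_le_one_iff.2 (by linarith)
      nlinarith

variable {Ω : Type*} [MeasurableSpace Ω] {P : Measure Ω} [IsProbabilityMeasure P]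
  {Z : Ω → ℝ} {σ : ℝ}

/-- Layer cake: with the tail `2 exp(-2u)` of `Z² / (4σ²)`, the exponential moment is at most
`1 + ∫ 2 exp(-2u) exp u du = 3`. -/
theorem lintegral_exp_sq_sub_one_le (hZ : Measurable Z) (hσ : 0 < σ)
    (htail : ∀ t : ℝ, 0 < t → P.real {ω | t < |Z ω|} ≤ 2 * exp (-(t ^ 2 / (2 * σ ^ 2)))) :
    ∫⁻ ω, ENNReal.ofReal (exp (Z ω ^ 2 / (4 * σ ^ 2)) - 1) ∂P ≤ 2 := by
  have h := lintegral_comp_eq_lintegral_meas_lt_mul P (f := fun ω => Z ω ^ 2 / (4 * σ ^ 2))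
    (g := exp) (Filter.Eventually.of_forall fun ω => by positivity) (by fun_prop)
    (fun t _ => continuous_exp.intervalIntegrable 0 t)
    (Filter.Eventually.of_forall fun t => (exp_pos t).le)
  simp only [integral_exp, exp_zero] at h
  rw [h]
  calc ∫⁻ u in Set.Ioi 0, P {ω | u < Z ω ^ 2 / (4 * σ ^ 2)} * ENNReal.ofReal (exp u)
      ≤ ∫⁻ u in Set.Ioi (0 : ℝ), ENNReal.ofReal (2 * exp (-u)) := by
        refine setLIntegral_mono (by fun_prop) fun u hu => ?_
        have hu : 0 < u := hu
        have hset : {ω | u < Z ω ^ 2 / (4 * σ ^ 2)} ⊆ {ω | 2 * σ * √u < |Z ω|} := by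
          intro ω hω
          have hω : u < Z ω ^ 2 / (4 * σ ^ 2) := hω
          rw [lt_div_iff₀ (by positivity)] at hω
          refine lt_of_pow_lt_pow_left₀ 2 (abs_nonneg (Z ω)) ?_
          rw [sq_abs, mul_pow, sq_sqrt hu.le]
          linarith
        have h1 : P.real {ω | u < Z ω ^ 2 / (4 * σ ^ 2)} ≤ 2 * exp (-(2 * u)) := by
          refine (measureReal_mono hset).trans ((htail _ (by positivity)).trans_eq ?_)
          rw [mul_pow, sq_sqrt hu.le]
          congr 3
          field_simp
        rw [← ofReal_measureReal, ← ENNReal.ofReal_mul measureReal_nonneg]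
        refine ENNReal.ofReal_le_ofReal ?_
        calc _ ≤ 2 * exp (-(2 * u)) * exp u := mul_le_mul_of_nonneg_right h1 (exp_pos u).le
          _ = 2 * exp (-u) := by rw [mul_assoc, ← exp_add]; ring_nf
    _ = ENNReal.ofReal (∫ u in Set.Ioi (0 : ℝ), 2 * exp (-u)) := by
        refine (ofReal_integral_eq_lintegral_ofReal ?_ ?_).symm
        · exact ((by simpa using integrableOn_exp_mul_Ioi (a := -1) (by norm_num) 0 :
            IntegrableOn (fun u : ℝ => exp (-u)) (Set.Ioi 0))).const_mul 2
        · exact Filter.Eventually.of_forall fun u => by positivity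
    _ = 2 := by rw [integral_const_mul, integral_exp_neg_Ioi_zero]; simp

theorem integrable_exp_sq (hZ : Measurable Z) (hσ : 0 < σ)
    (htail : ∀ t : ℝ, 0 < t → P.real {ω | t < |Z ω|} ≤ 2 * exp (-(t ^ 2 / (2 * σ ^ 2)))) :
    Integrable (fun ω => exp (Z ω ^ 2 / (4 * σ ^ 2))) P ∧
      ∫ ω, exp (Z ω ^ 2 / (4 * σ ^ 2)) ∂P ≤ 3 := by
  have h := lintegral_exp_sq_sub_one_le hZ hσ htail
  have hnn : ∀ ω, 0 ≤ exp (Z ω ^ 2 / (4 * σ ^ 2)) - 1 := fun ω => by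
    have : 1 ≤ exp (Z ω ^ 2 / (4 * σ ^ 2)) := one_le_exp (by positivity)
    linarith
  have hmeas : Measurable fun ω => exp (Z ω ^ 2 / (4 * σ ^ 2)) - 1 := by fun_prop
  have hint : Integrable (fun ω => exp (Z ω ^ 2 / (4 * σ ^ 2)) - 1) P := by
    refine ⟨hmeas.aestronglyMeasurable, ?_⟩
    rw [hasFiniteIntegral_iff_ofReal (Filter.Eventually.of_forall hnn)]
    exact h.trans_lt (by simp)
  have hint' : Integrable (fun ω => exp (Z ω ^ 2 / (4 * σ ^ 2))) P := by
    exact (hint.add (integrable_const (1 : ℝ))).congr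
      (Filter.Eventually.of_forall fun ω => by simp)
  refine ⟨hint', ?_⟩
  have h1 : ∫ ω, (exp (Z ω ^ 2 / (4 * σ ^ 2)) - 1) ∂P ≤ 2 := by
    rw [integral_eq_lintegral_of_nonneg_ae (Filter.Eventually.of_forall hnn)
      hmeas.aestronglyMeasurable]
    exact ENNReal.toReal_le_of_le_ofReal (by norm_num) (by simpa using h)
  rw [integral_sub hint' (integrable_const _)] at h1
  simp at h1
  linarith

/-- A centered variable with sub-Gaussian tails of parameter `σ²` has a sub-Gaussian moment
generating function with variance proxy `18 σ²`. -/
theorem hasSubgaussianMGF_of_tail (hZ : Measurable Z) (hσ : 0 < σ)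
    (hmean : ∫ ω, Z ω ∂P = 0)
    (htail : ∀ t : ℝ, 0 < t → P.real {ω | t < |Z ω|} ≤ 2 * exp (-(t ^ 2 / (2 * σ ^ 2)))) :
    HasSubgaussianMGF Z (18 * σ ^ 2).toNNReal P := by
  obtain ⟨hint, hle⟩ := integrable_exp_sq hZ hσ htail
  have hpt : ∀ t x : ℝ, exp (t * x) ≤ exp (σ ^ 2 * t ^ 2) * exp (x ^ 2 / (4 * σ ^ 2)) := by
    intro t x
    rw [← exp_add, exp_le_exp]
    have h1 : x ^ 2 / (4 * σ ^ 2) = (x / (2 * σ)) ^ 2 := by rw [div_pow]; ring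
    have h2 : t * x = 2 * (σ * t) * (x / (2 * σ)) := by field_simp
    rw [h1, h2]
    nlinarith [sq_nonneg (σ * t - x / (2 * σ))]
  have hexp : ∀ t : ℝ, Integrable (fun ω => exp (t * Z ω)) P := by
    intro t
    refine (hint.const_mul (exp (σ ^ 2 * t ^ 2))).mono' (by fun_prop)
      (Filter.Eventually.of_forall fun ω => ?_)
    rw [norm_eq_abs, abs_of_pos (exp_pos _)]
    exact hpt t (Z ω)
  have hZint : Integrable Z P := by
    refine ((hexp 1).add (hexp (-1))).mono' hZ.aestronglyMeasurable
      (Filter.Eventually.of_forall fun ω => ?_)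
    have h1 := add_one_le_exp (1 * Z ω)
    have h2 := add_one_le_exp (-1 * Z ω)
    have h3 := exp_pos (1 * Z ω)
    have h4 := exp_pos (-1 * Z ω)
    simp only [Pi.add_apply]
    rw [norm_eq_abs, abs_le]
    constructor <;> linarith
  refine ⟨hexp, fun t => ?_⟩
  rw [coe_toNNReal _ (by positivity), mgf]
  rcases le_total (4 * σ ^ 2 * t ^ 2) 1 with ht | ht
  · -- For small `t`, the linear term of `exp x ≤ x + exp (x²)` vanishes in mean, and convexity
    -- interpolates `exp (t² Z²)` between `1` and `exp (Z² / (4σ²))`.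
    set θ := 4 * σ ^ 2 * t ^ 2 with hθ
    have hθ0 : 0 ≤ θ := by positivity
    have hpt' : ∀ x : ℝ, exp (t * x) ≤ t * x + ((1 - θ) + θ * exp (x ^ 2 / (4 * σ ^ 2))) := by
      intro x
      refine (exp_le_add_exp_sq (t * x)).trans (add_le_add_right ?_ _)
      have hconv := convexOn_exp.2 (Set.mem_univ 0) (Set.mem_univ (x ^ 2 / (4 * σ ^ 2)))
        (sub_nonneg.2 ht) hθ0 (by ring)
      have h1 : (1 - θ) • (0 : ℝ) + θ • (x ^ 2 / (4 * σ ^ 2)) = (t * x) ^ 2 := by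
        simp only [smul_eq_mul, hθ]
        field_simp
        ring
      rw [h1] at hconv
      simpa using hconv
    have hcomb : Integrable (fun ω => (1 - θ) + θ * exp (Z ω ^ 2 / (4 * σ ^ 2))) P :=
      (integrable_const _).add (hint.const_mul θ)
    calc ∫ ω, exp (t * Z ω) ∂P
        ≤ ∫ ω, (t * Z ω + ((1 - θ) + θ * exp (Z ω ^ 2 / (4 * σ ^ 2)))) ∂P :=
          integral_mono (hexp t) ((hZint.const_mul t).add hcomb) fun ω => hpt' (Z ω)
      _ = (1 - θ) + θ * ∫ ω, exp (Z ω ^ 2 / (4 * σ ^ 2)) ∂P := by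
          rw [integral_add (hZint.const_mul t) hcomb, integral_add (integrable_const _) (hint.const_mul θ), integral_const_mul,
            integral_const_mul, hmean]
          simp
      _ ≤ (1 - θ) + θ * 3 := by gcongr
      _ ≤ 2 * θ + 1 := by linarith
      _ ≤ exp (2 * θ) := add_one_le_exp _
      _ ≤ exp (18 * σ ^ 2 * t ^ 2 / 2) := exp_le_exp.2 (by nlinarith)
  · calc ∫ ω, exp (t * Z ω) ∂P
        ≤ ∫ ω, exp (σ ^ 2 * t ^ 2) * exp (Z ω ^ 2 / (4 * σ ^ 2)) ∂P :=
          integral_mono (hexp t) (hint.const_mul _) fun ω => hpt t (Z ω)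
      _ = exp (σ ^ 2 * t ^ 2) * ∫ ω, exp (Z ω ^ 2 / (4 * σ ^ 2)) ∂P := integral_const_mul _ _
      _ ≤ exp (σ ^ 2 * t ^ 2) * 3 := by gcongr
      _ ≤ exp (σ ^ 2 * t ^ 2) * exp 2 := by
          gcongr
          linarith [add_one_le_exp (2 : ℝ)]
      _ ≤ exp (18 * σ ^ 2 * t ^ 2 / 2) := by
          rw [← exp_add, exp_le_exp]
          linarith

/-- Hoeffding bound for a weighted average of the noise with normalized weights. -/
theorem IsSubGaussianNoise.crossMoment_tail {n : ℕ} {ι : Type*} {w : Fin n → Ω → ℝ}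
    (hw : IsSubGaussianNoise P w σ) (hσ : 0 < σ) {X : Matrix (Fin n) ι ℝ}
    (hX : NormalizedColumns X) (hn : 0 < n) (j : ι) {t : ℝ} (ht : 0 ≤ t) :
    P.real {ω | t ≤ |crossMoment X (fun i => w i ω) j|} ≤
      2 * exp (-(n * t ^ 2 / (36 * σ ^ 2))) := by
  have hn' : (0 : ℝ) < n := by exact_mod_cast hn
  set a : Fin n → ℝ := fun i => X i j / n with ha
  have hsq : ∑ i, a i ^ 2 = 1 / n := by
    have h1 := hX j
    simp only [ha, div_pow, ← Finset.sum_div]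
    field_simp at h1 ⊢
    exact h1
  have hsub : ∀ i, HasSubgaussianMGF (w i) (18 * σ ^ 2).toNNReal P := fun i =>
    hasSubgaussianMGF_of_tail (hw.measurable i) hσ (hw.mean_zero i) (hw.tail i)
  have hone : ∀ b : Fin n → ℝ, ∑ i, b i ^ 2 = 1 / n →
      P.real {ω | t ≤ ∑ i, b i * w i ω} ≤ exp (-(n * t ^ 2 / (36 * σ ^ 2))) := by
    intro b hb
    have hind : iIndepFun (fun i ω => b i * w i ω) P :=
      hw.indep.comp (fun i x => b i * x) fun i => by fun_prop
    have hmul : ∀ i, HasSubgaussianMGF (fun ω => b i * w i ω)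
        (NNReal.mk (b i ^ 2) (sq_nonneg _) * (18 * σ ^ 2).toNNReal) P :=
      fun i => (hsub i).const_mul (b i)
    have h := HasSubgaussianMGF.measure_sum_ge_le_of_iIndepFun hind (s := Finset.univ)
      (fun i _ => hmul i) ht
    refine h.trans_eq ?_
    congr 1
    have hc : ((∑ i, NNReal.mk (b i ^ 2) (sq_nonneg _) * (18 * σ ^ 2).toNNReal : NNReal) : ℝ)
        = 18 * σ ^ 2 / n := by
      rw [NNReal.coe_sum]
      simp only [NNReal.coe_mul, NNReal.coe_mk]
      rw [← Finset.sum_mul, hb, coe_toNNReal _ (by positivity)]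
      ring
    rw [hc]
    field_simp
    ring
  have hcm : ∀ ω, crossMoment X (fun i => w i ω) j = ∑ i, a i * w i ω := by
    intro ω
    simp only [crossMoment, Pi.smul_apply, Matrix.mulVec, dotProduct, smul_eq_mul,
      Matrix.transpose_apply, Finset.mul_sum, ha]
    exact Finset.sum_congr rfl fun i _ => by ring
  have hset : {ω | t ≤ |crossMoment X (fun i => w i ω) j|} ⊆
      {ω | t ≤ ∑ i, a i * w i ω} ∪ {ω | t ≤ ∑ i, -a i * w i ω} := by
    intro ω hω
    rw [Set.mem_ofPred_eq, hcm, le_abs] at hω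
    simpa [neg_mul, Finset.sum_neg_distrib] using hω
  calc _ ≤ P.real {ω | t ≤ ∑ i, a i * w i ω} + P.real {ω | t ≤ ∑ i, -a i * w i ω} :=
        (measureReal_mono hset).trans (measureReal_union_le _ _)
    _ ≤ _ := by
        have h1 := hone a hsq
        have h2 := hone (fun i => -a i) (by simpa using hsq)
        linarith

end Tail

end CoCoLasso

/-! ### The good event -/

namespace CoCoLasso

theorem gram_posSemidef {n : ℕ} {ι : Type*} [Finite ι] (X : Matrix (Fin n) ι ℝ) :
    (gram X).PosSemidef := by
  have h := Matrix.posSemidef_conjTranspose_mul_self X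
  rw [Matrix.conjTranspose_eq_transpose_of_trivial] at h
  exact h.smul (by positivity)

theorem crossMoment_linear_model {n : ℕ} {ι : Type*} [Fintype ι] (X : Matrix (Fin n) ι ℝ)
    {y w : Fin n → ℝ} {β : ι → ℝ} (hy : ∀ i, y i = X.mulVec β i + w i) :
    crossMoment X y = (gram X).mulVec β + crossMoment X w := by
  have : y = X.mulVec β + w := funext hy
  simp only [crossMoment, gram, this, Matrix.mulVec_add, smul_add, Matrix.smul_mulVec,
    Matrix.mulVec_mulVec]

theorem measurable_crossMoment {Ω : Type*} [MeasurableSpace Ω] {n : ℕ} {ι : Type*}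
    (X : Matrix (Fin n) ι ℝ) {z : Fin n → Ω → ℝ} (hz : ∀ i, Measurable (z i)) (j : ι) :
    Measurable fun ω => crossMoment X (fun i => z i ω) j := by
  simp only [crossMoment, Pi.smul_apply, Matrix.mulVec, dotProduct, smul_eq_mul]
  fun_prop

theorem measureReal_iUnion_le_card_mul {Ω : Type*} [MeasurableSpace Ω] {P : Measure Ω}
    {α : Type*} [Fintype α] {U : α → Set Ω} {q : ℝ} (h : ∀ a, P.real (U a) ≤ q) :
    P.real (⋃ a, U a) ≤ Fintype.card α * q := by
  calc P.real (⋃ a, U a) ≤ ∑ a, P.real (U a) := measureReal_iUnion_fintype_le U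
    _ ≤ ∑ _a : α, q := Finset.sum_le_sum fun a _ => h a
    _ = _ := by simp

/-- The event on which the surrogates and the noise are small. Its complement is a union of `p²`
events for the matrix and `p` events each for `ρtil` and for the noise; the latter two are both
counted `p²` times in `failureBound`. -/
theorem exists_good_event {Ω : Type*} [MeasurableSpace Ω] {P : Measure Ω} [IsProbabilityMeasure P]
    {n s r : ℕ} {C₀ c₀ γ ε₀ σ ζ lam ε : ℝ} (hC₀ : 0 < C₀) (hc₀ : 0 < c₀) (hs : 0 < s)
    (hn : 0 < n) {X : Matrix (Fin n) (Fin s ⊕ Fin r) ℝ} {w : Fin n → Ω → ℝ}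
    {Khat : Ω → Matrix (Fin s ⊕ Fin r) (Fin s ⊕ Fin r) ℝ}
    {K : Matrix (Fin s ⊕ Fin r) (Fin s ⊕ Fin r) ℝ}
    {ρ ρtil : Ω → Fin s ⊕ Fin r → ℝ}
    (hX : NormalizedColumns X) (hσ : 0 < σ) (hw : IsSubGaussianNoise P w σ)
    (hKm : ∀ i j, Measurable fun ω => Khat ω i j) (hρm : ∀ j, Measurable fun ω => ρ ω j)
    (hρtm : ∀ j, Measurable fun ω => ρtil ω j) (hζ : 0 < ζ)
    (hclose : Closeness P n s C₀ c₀ ζ ε₀ K ρ Khat ρtil)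
    (hγ : 0 < γ) (hlam : 0 < lam) (hlamε : γ * lam / 32 ≤ ε₀) (hε : 0 < ε) (hεε : ε ≤ ε₀) :
    ∃ E : Set Ω, MeasurableSet E ∧
      1 - failureBound (C₀ + 2) (min (c₀ / 1024) (1 / 36864)) n (s + r) s γ lam ε (max ζ (σ ^ 2))
        ≤ P.real E ∧
      ∀ ω ∈ E, (∀ i j, |Khat ω i j - K i j| ≤ ε) ∧ (∀ j, |ρtil ω j - ρ ω j| ≤ γ * lam / 32) ∧
        ∀ j, |crossMoment X (fun i => w i ω) j| ≤ γ * lam / 32 := by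
  set t := γ * lam / 32 with ht
  have ht0 : 0 < t := by positivity
  set m := max ζ (σ ^ 2) with hm
  have hm0 : 0 < m := lt_max_of_lt_left hζ
  set c := min (c₀ / 1024) (1 / 36864) with hc
  have hc0 : 0 < c := lt_min (by positivity) (by norm_num)
  have hcc : c * 1024 ≤ c₀ := by
    have := min_le_left (c₀ / 1024) (1 / 36864)
    rw [← hc] at this
    linarith
  have hcσ : c * 36864 ≤ 1 := by
    have := min_le_right (c₀ / 1024) (1 / 36864)
    rw [← hc] at this
    linarith
  have hs1 : (1 : ℝ) ≤ (s : ℝ) ^ 2 := one_le_pow₀ (by exact_mod_cast hs)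
  have hs0 : (0 : ℝ) < (s : ℝ) ^ 2 := by linarith
  have hn0 : (0 : ℝ) < n := by exact_mod_cast hn
  set e₁ := Real.exp (-(c * n * γ ^ 2 * lam ^ 2 / ((s : ℝ) ^ 2 * m))) with he₁
  set e₂ := Real.exp (-(c * n * ε ^ 2 / ((s : ℝ) ^ 2 * m))) with he₂
  have he₁0 : 0 < e₁ := Real.exp_pos _
  have he₂0 : 0 < e₂ := Real.exp_pos _
  set U₁ : (Fin s ⊕ Fin r) × (Fin s ⊕ Fin r) → Set Ω :=
    fun a => {ω | ε ≤ |Khat ω a.1 a.2 - K a.1 a.2|} with hU₁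
  set U₂ : Fin s ⊕ Fin r → Set Ω := fun j => {ω | t ≤ |ρtil ω j - ρ ω j|} with hU₂
  set U₃ : Fin s ⊕ Fin r → Set Ω :=
    fun j => {ω | t ≤ |crossMoment X (fun i => w i ω) j|} with hU₃
  have hb₁ : ∀ a, P.real (U₁ a) ≤ C₀ * e₂ := by
    intro a
    refine ((hclose ε hε hεε).1 a.1 a.2).trans ?_
    refine mul_le_mul_of_nonneg_left (Real.exp_le_exp.2 (neg_le_neg ?_)) hC₀.le
    have h1 : ζ ≤ (s : ℝ) ^ 2 * m := by
      have : ζ ≤ m := le_max_left _ _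
      nlinarith
    have h2 : c ≤ c₀ := by linarith
    gcongr
  have hb₂ : ∀ j, P.real (U₂ j) ≤ C₀ * e₁ := by
    intro j
    refine ((hclose t ht0 hlamε).2 j).trans ?_
    refine mul_le_mul_of_nonneg_left (Real.exp_le_exp.2 (neg_le_neg ?_)) hC₀.le
    have h1 : ζ ≤ m := le_max_left _ _
    have h2 : c * n * γ ^ 2 * lam ^ 2 ≤ c₀ * n * t ^ 2 := by
      have : c * 1024 * (n * t ^ 2) ≤ c₀ * (n * t ^ 2) := by gcongr
      have h3 : c * 1024 * (n * t ^ 2) = c * n * γ ^ 2 * lam ^ 2 := by rw [ht]; ring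
      linarith
    gcongr
  have hb₃ : ∀ j, P.real (U₃ j) ≤ 2 * e₁ := by
    intro j
    refine (hw.crossMoment_tail hσ hX hn j ht0.le).trans ?_
    refine mul_le_mul_of_nonneg_left (Real.exp_le_exp.2 (neg_le_neg ?_)) zero_le_two
    have h1 : σ ^ 2 ≤ (s : ℝ) ^ 2 * m := by
      have : σ ^ 2 ≤ m := le_max_right _ _
      nlinarith
    have h2 : c * n * γ ^ 2 * lam ^ 2 ≤ n * t ^ 2 / 36 := by
      have : c * 36864 * (n * t ^ 2 / 36) ≤ 1 * (n * t ^ 2 / 36) := by gcongr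
      have h3 : c * 36864 * (n * t ^ 2 / 36) = c * n * γ ^ 2 * lam ^ 2 := by rw [ht]; ring
      linarith
    rw [← div_div (n * t ^ 2)]
    gcongr
  have hcard : (1 : ℝ) ≤ ((s + r : ℕ) : ℝ) := by exact_mod_cast (by omega : 1 ≤ s + r)
  have hm₁ : ∀ a, MeasurableSet (U₁ a) := fun a =>
    measurableSet_le measurable_const ((hKm a.1 a.2).sub_const _).abs
  have hm₂ : ∀ j, MeasurableSet (U₂ j) := fun j =>
    measurableSet_le measurable_const ((hρtm j).sub (hρm j)).abs
  have hm₃ : ∀ j, MeasurableSet (U₃ j) := fun j =>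
    measurableSet_le measurable_const (measurable_crossMoment X hw.measurable j).abs
  have hmeas : MeasurableSet ((⋃ a, U₁ a) ∪ (⋃ j, U₂ j) ∪ ⋃ j, U₃ j) :=
    ((MeasurableSet.iUnion hm₁).union (MeasurableSet.iUnion hm₂)).union (MeasurableSet.iUnion hm₃)
  refine ⟨((⋃ a, U₁ a) ∪ (⋃ j, U₂ j) ∪ ⋃ j, U₃ j)ᶜ, hmeas.compl, ?_, fun ω hω => ?_⟩
  · rw [probReal_compl_eq_one_sub hmeas]
    refine sub_le_sub_left ?_ 1
    have h1 := measureReal_iUnion_le_card_mul hb₁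
    have h2 := measureReal_iUnion_le_card_mul hb₂
    have h3 := measureReal_iUnion_le_card_mul hb₃
    have h4 := measureReal_union_le (μ := P) ((⋃ a, U₁ a) ∪ ⋃ j, U₂ j) (⋃ j, U₃ j)
    have h5 := measureReal_union_le (μ := P) (⋃ a, U₁ a) (⋃ j, U₂ j)
    simp only [Fintype.card_prod, Fintype.card_sum, Fintype.card_fin] at h1 h2 h3
    set p : ℝ := ((s + r : ℕ) : ℝ) with hp
    rw [Nat.cast_mul, ← hp] at h1
    have hpp : p ≤ p ^ 2 := by nlinarith
    have h6 : p * (C₀ * e₁) ≤ p ^ 2 * (C₀ * e₁) := by gcongr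
    have h7 : p * (2 * e₁) ≤ p ^ 2 * (2 * e₁) := by gcongr
    have h8 : 0 ≤ p ^ 2 * (2 * e₂) := by positivity
    simp only [failureBound, ← hp, ← he₁, ← he₂]
    nlinarith
  · simp only [Set.mem_compl_iff, Set.mem_union, Set.mem_iUnion, not_or, not_exists] at hω
    obtain ⟨⟨h1, h2⟩, h3⟩ := hω
    exact ⟨fun i j => (not_le.1 (h1 (i, j))).le, fun j => (not_le.1 (h2 j)).le,
      fun j => (not_le.1 (h3 j)).le⟩

theorem isUnit_of_isMinEigenvalue_pos {ι : Type*} [Fintype ι] [DecidableEq ι] {A : Matrix ι ι ℝ}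
    {m : ℝ} (hA : IsMinEigenvalue A m) (hm : 0 < m) : IsUnit A :=
  spectrum.zero_notMem_iff ℝ |>.1 fun h => absurd (hA.2 h) (not_le.2 hm)

theorem sign_eq_sign_of_abs_sub_lt {a b : ℝ} (h : |a - b| < |b|) :
    SignType.sign a = SignType.sign b := by
  rcases lt_trichotomy b 0 with hb | rfl | hb
  · rw [abs_of_neg hb, abs_lt] at h
    rw [sign_neg hb, sign_neg (by linarith)]
  · simp at h
    exact absurd h (not_lt.2 (abs_nonneg a))
  · rw [abs_of_pos hb, abs_lt] at h
    rw [sign_pos hb, sign_pos (by linarith)]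

end CoCoLasso

theorem theorem2 (C₀ c₀ : ℝ) (hC₀ : 0 < C₀) (hc₀ : 0 < c₀) :
    -- universal constants: they depend on the constants of the closeness condition only
    ∃ C c : ℝ, 0 < C ∧ 0 < c ∧
    -- `A` is the block `Σ_{S,S}` and `βS` the vector of nonzero coefficients
    ∀ (s : ℕ) (A : Matrix (Fin s) (Fin s) ℝ) (βS : Fin s → ℝ) (γ ε₀ : ℝ),
    0 < s → 0 < γ → 0 < ε₀ →
    ∃ ε₁ ε₂ ε₃ : ℝ, 0 < ε₁ ∧ 0 < ε₂ ∧ 0 < ε₃ ∧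
    ∀ (Ω : Type*) [MeasurableSpace Ω] (P : Measure Ω) [IsProbabilityMeasure P]
      (n r : ℕ) (X : Matrix (Fin n) (Fin s ⊕ Fin r) ℝ)
      (w : Fin n → Ω → ℝ) (y : Ω → Fin n → ℝ)
      (Khat Ktil : Ω → Matrix (Fin s ⊕ Fin r) (Fin s ⊕ Fin r) ℝ)
      (ρtil : Ω → Fin s ⊕ Fin r → ℝ)
      (σ ζ Cmin lam ε : ℝ),
    -- the linear model `y = X β* + w` with fixed normalized design
    (∀ j, βS j ≠ 0) →
    CoCoLasso.NormalizedColumns X →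
    0 < σ → CoCoLasso.IsSubGaussianNoise P w σ →
    (∀ ω i, y ω i = X.mulVec (CoCoLasso.fullCoef βS) i + w i ω) →
    -- the surrogates and the closeness condition
    (∀ i j, Measurable fun ω => Khat ω i j) →
    (∀ j, Measurable fun ω => ρtil ω j) →
    0 < ζ →
    CoCoLasso.Closeness P n s C₀ c₀ ζ ε₀ (CoCoLasso.gram X)
      (fun ω => CoCoLasso.crossMoment X (y ω)) Khat ρtil →
    (∀ ω, CoCoLasso.IsNearestPSD (Khat ω) (Ktil ω)) →
    -- the irrepresentable and minimum eigenvalue conditions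
    (CoCoLasso.gram X).toBlocks₁₁ = A →
    CoCoLasso.linftyNorm ((CoCoLasso.gram X).toBlocks₂₁ * A⁻¹) = 1 - γ →
    CoCoLasso.IsMinEigenvalue A Cmin → 0 < Cmin →
    -- the ranges of the two parameters
    0 < lam → lam ≤ min ε₀ (4 * ε₀ / γ) →
    0 < ε → ε ≤ min ε₁ (lam / (lam * ε₂ + ε₃)) →
    -- the conclusion holds on an event of probability at least `1 - δ₁`
    ∃ E : Set Ω, MeasurableSet E ∧
      1 - CoCoLasso.failureBound C c n (s + r) s γ lam ε (max ζ (σ ^ 2)) ≤ P.real E ∧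
      ∀ ω ∈ E, ∃ βhat : Fin s ⊕ Fin r → ℝ,
        (CoCoLasso.IsSolution (Ktil ω) (ρtil ω) lam βhat ∧
          (∀ β', CoCoLasso.IsSolution (Ktil ω) (ρtil ω) lam β' → β' = βhat) ∧
          (∀ j : Fin r, βhat (Sum.inr j) = 0)) ∧
        ‖(fun j => βhat (Sum.inl j)) - βS‖ ≤ CoCoLasso.kappa A Cmin * lam ∧
        (CoCoLasso.kappa A Cmin * lam ≤ ⨅ j, |βS j| →
          ∀ j, SignType.sign (βhat (Sum.inl j)) = SignType.sign (βS j)) := by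
  refine ⟨C₀ + 2, min (c₀ / 1024) (1 / 36864), by positivity, lt_min (by positivity) (by norm_num),
    fun s A βS γ ε₀ hs hγ hε₀ => ?_⟩
  set M := CoCoLasso.linftyNorm A⁻¹ with hMdef
  set B := ∑ j, |βS j| with hBdef
  have hM : 0 ≤ M := CoCoLasso.linftyNorm_nonneg _
  have hB : 0 ≤ B := Finset.sum_nonneg fun _ _ => abs_nonneg _
  -- `ε₁` keeps the perturbed design within half the irrepresentability margin, and `ε₃` makes the
  -- bias `2 ε ‖βS‖₁` at most `γ lam / 16`.
  refine ⟨min ε₀ (γ / (16 * (s * M) + 1)), 1, 32 * B / γ + 1, lt_min hε₀ (by positivity), one_pos,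
    by positivity, ?_⟩
  intro Ω _ P _ n r X w y Khat Ktil ρtil σ ζ Cmin lam ε _ hX hσ hw hy hKm hρm hζ hclose hnear hA
    hirr hmin hCmin hlam hlam' hε hε'
  have hn : 0 < n := by
    rcases Nat.eq_zero_or_pos n with rfl | h
    · simpa using hX (Sum.inl ⟨0, hs⟩)
    · exact h
  have hε1 : ε ≤ ε₀ := hε'.trans ((min_le_left _ _).trans (min_le_left _ _))
  have hε2 : ε * (16 * (s * M) + 1) ≤ γ :=
    (le_div_iff₀ (by positivity)).1 (hε'.trans ((min_le_left _ _).trans (min_le_right _ _)))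
  have hε3 : ε * (lam * 1 + (32 * B / γ + 1)) ≤ lam :=
    (le_div_iff₀ (by positivity)).1 (hε'.trans (min_le_right _ _))
  have hlamε : γ * lam / 32 ≤ ε₀ := by
    have h := (le_div_iff₀ hγ).1 (hlam'.trans (min_le_right _ _))
    linarith
  have hbias : 2 * ε * B ≤ γ * lam / 16 := by
    have h1 : ε * (32 * B / γ) ≤ lam := by nlinarith
    have h2 : ε * (32 * B / γ) * γ ≤ lam * γ := mul_le_mul_of_nonneg_right h1 hγ.le
    have h3 : ε * (32 * B / γ) * γ = 32 * (ε * B) := by field_simp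
    linarith
  have hym : ∀ i, Measurable fun ω => y ω i := fun i => by
    simp only [hy]
    exact (hw.measurable i).const_add _
  obtain ⟨E, hEm, hEp, hE⟩ := CoCoLasso.exists_good_event hC₀ hc₀ hs hn hX hσ hw hKm
    (fun j => CoCoLasso.measurable_crossMoment X hym j) hρm hζ hclose hγ hlam hlamε hε hε1
  refine ⟨E, hEm, hEp, fun ω hω => ?_⟩
  obtain ⟨h1, h2, h3⟩ := hE ω hω
  have hD := (hnear ω).abs_sub_le (CoCoLasso.gram_posSemidef X) hε.le h1
  have hρ : ∀ j, |ρtil ω j - ((CoCoLasso.gram X).mulVec (Sum.elim βS 0)) j| ≤ γ * lam / 16 := by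
    intro j
    have h4 := congrFun (CoCoLasso.crossMoment_linear_model X (hy ω)) j
    have h5 := abs_le.1 (h2 j)
    have h6 := abs_le.1 (h3 j)
    simp only [Pi.add_apply, CoCoLasso.fullCoef] at h4
    change CoCoLasso.crossMoment X (fun i => y ω i) j = _ at h4
    rw [h4] at h5
    rw [abs_le]
    constructor <;> linarith [h5.1, h5.2, h6.1, h6.2]
  subst hA
  obtain ⟨b, ⟨hsol, huniq⟩, hb⟩ := CoCoLasso.exists_unique_solution_of_close (hnear ω).1
    (CoCoLasso.isUnit_of_isMinEigenvalue_pos hmin hCmin) hD (by positivity) hγ hirr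
    (by rw [Fintype.card_fin, ← hMdef]; nlinarith) hlam (by positivity) hρ (by linarith)
  -- The term `1 / √Cmin` of `kappa` makes the bound strict, as sign recovery requires.
  have hstrict : ‖b - βS‖ < CoCoLasso.kappa (CoCoLasso.gram X).toBlocks₁₁ Cmin * lam := by
    refine hb.trans_lt (mul_lt_mul_of_pos_right ?_ hlam)
    have : 0 < 1 / Real.sqrt Cmin := by positivity
    unfold CoCoLasso.kappa
    linarith
  refine ⟨Sum.elim b 0, ⟨hsol, huniq, fun j => rfl⟩, hstrict.le, fun hβmin j => ?_⟩
  refine CoCoLasso.sign_eq_sign_of_abs_sub_lt ?_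
  have h4 : ⨅ j, |βS j| ≤ |βS j| := ciInf_le (Set.finite_range _).bddBelow j
  calc |b j - βS j| ≤ ‖b - βS‖ := norm_le_pi_norm (b - βS) j
    _ < _ := hstrict
    _ ≤ _ := hβmin.trans h4
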